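/- Let $n_1,n_2,m_1,m_2\ge 0$ and let $(C_1,C_2)\in\{1,\dots,K_1\}\times\{1,\dots,K_2\}$ be a random pair of class labels with joint probability mass function $p$. Conditionally on $(C_1,C_2)=(i,k)$, let the vector $x=(x_1,x_2)$, with $x_1\in\mathbb{R}^{n_1}$ and $x_2\in\mathbb{R}^{n_2}$, be Gaussian with mean $\mu_x^{(ik)}$ and (possibly singular) covariance matrix $$\Sigma_x^{(ik)}=\begin{pmatrix}\Sigma_{x_1}^{(ik)}&\Sigma_{x_{12}}^{(ik)}\\ \Sigma_{x_{21}}^{(ik)}&\Sigma_{x_2}^{(ik)}\end{pmatrix}.$$ Put $r_x^{(ik)}=\operatorname{rank}\Sigma_x^{(ik)}$, $r_{x_1}^{(ik)}=\operatorname{rank}\Sigma_{x_1}^{(ik)}$, $r_{x_2}^{(ik)}=\operatorname{rank}\Sigma_{x_2}^{(ik)}$ and $\mathcal S=\{(i,k): p(i,k)>0\}$. Let $\Phi_1\in\mathbb{R}^{m_1\times n_1}$ and $\Phi_2\in\mathbb{R}^{m_2\times n_2}$ be independent random matrices, independent of the signals and the noise, each left rotation-invariant, i.e. the joint probability density $f$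 of its entries satisfies $f(\Theta A)=f(A)$ for every orthogonal $\Theta$ and every $A$; the case $m_2=n_2$, $\Phi_2=I$ is also allowed. For $\sigma^2>0$ let $$y_1=\Phi_1x_1+w_1,\qquad y_2=\Phi_2x_2+w_2,$$ where $w_1\sim\mathcal N(0,\sigma^2I)$ and $w_2\sim\mathcal N(0,\sigma^2I)$ are independent of each other and of $(C_1,C_2,x)$. For given $\Phi_1,\Phi_2$ let $$\mathrm{MMSE}(\sigma^2)=\mathbb{E}\,\big\|x_1-\mathbb{E}[x_1\mid y_1,y_2]\big\|^2 .$$ Suppose that for every $(i,k)\in\mathcal S$, either $m_1>r_{x_1}^{(ik)}$, or both $m_1>r_x^{(ik)}-r_{x_2}^{(ik)}$ and $m_1+m_2>r_x^{(ik)}$. Then, with probability $1$ (with respect to the random choice of $\Phi_1,\Phi_2$), $$\lim_{\sigma^2\to0^+}\mathrm{MMSE}(\sigma^2)=0 .$$ -/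

import Mathlib

open MeasureTheory ProbabilityTheory Filter Topology
open scoped ENNReal

noncomputable section

namespace GMMSideInfo

/-- Real matrices, measured entry by entry, with Lebesgue measure on the entries. -/
instance matrixMeasureSpace (m n : ℕ) : MeasureSpace (Matrix (Fin m) (Fin n) ℝ) :=
  inferInstanceAs (MeasureSpace (Fin m → Fin n → ℝ))

/-- The random matrix `Φ` is left rotation-invariant: its entries have a joint probability density
`f` with `f (Θ A) = f A` for every orthogonal `Θ` and every matrix `A`. -/
def IsLeftRotationInvariant {Ω : Type*} [MeasurableSpace Ω] (P : Measure Ω) {m n : ℕ}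
    (Φ : Ω → Matrix (Fin m) (Fin n) ℝ) : Prop :=
  ∃ f : Matrix (Fin m) (Fin n) ℝ → ℝ≥0∞, Measurable f ∧
    P.map Φ = (volume : Measure (Matrix (Fin m) (Fin n) ℝ)).withDensity f ∧
    ∀ Θ ∈ Matrix.orthogonalGroup (Fin m) ℝ, ∀ A, f (Θ * A) = f A

/-- The `m × n` matrix `A` is an identity matrix. -/
def IsIdentityKernel {m n : ℕ} (A : Matrix (Fin m) (Fin n) ℝ) : Prop :=
  m = n ∧ ∀ a b, A a b = if (a : ℕ) = (b : ℕ) then 1 else 0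

/-- A joint Gaussian mixture model for `(x₁, x₂) ∈ ℝ^{n₁} × ℝ^{n₂}`, with class labels
`(C₁, C₂)` in `{1, …, K₁} × {1, …, K₂}`. -/
structure JointGMM (n₁ n₂ K₁ K₂ : ℕ) where
  /-- joint probability mass function of the pair of class labels -/
  p : PMF (Fin K₁ × Fin K₂)
  /-- mean of `x = (x₁, x₂)` given the pair of class labels -/
  mean : Fin K₁ × Fin K₂ → EuclideanSpace ℝ (Fin n₁ ⊕ Fin n₂)
  /-- covariance matrix of `x = (x₁, x₂)` given the pair of class labels -/
  cov : Fin K₁ × Fin K₂ → Matrix (Fin n₁ ⊕ Fin n₂) (Fin n₁ ⊕ Fin n₂) ℝ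
  cov_posSemidef : ∀ c, (cov c).PosSemidef

/-- The first block `x₁` of `x = (x₁, x₂)`. -/
def fstBlock {n₁ n₂ : ℕ} (x : EuclideanSpace ℝ (Fin n₁ ⊕ Fin n₂)) : EuclideanSpace ℝ (Fin n₁) :=
  WithLp.toLp 2 (fun a => x (Sum.inl a))

/-- The second block `x₂` of `x = (x₁, x₂)`. -/
def sndBlock {n₁ n₂ : ℕ} (x : EuclideanSpace ℝ (Fin n₁ ⊕ Fin n₂)) : EuclideanSpace ℝ (Fin n₂) :=
  WithLp.toLp 2 (fun b => x (Sum.inr b))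

/-- `𝒩(0, σ² I)` on `ℝ^m`; the argument `s` is the variance `σ²`. -/
def noiseLaw (m : ℕ) (s : ℝ) : Measure (EuclideanSpace ℝ (Fin m)) :=
  multivariateGaussian 0 (s • (1 : Matrix (Fin m) (Fin m) ℝ))

/-- The observation `y = Φ x + w`. -/
def observe {m n : ℕ} (Φ : Matrix (Fin m) (Fin n) ℝ) (x : EuclideanSpace ℝ (Fin n))
    (w : EuclideanSpace ℝ (Fin m)) : EuclideanSpace ℝ (Fin m) :=
  Matrix.toEuclideanLin Φ x + w

/-- Minimum mean-square error in estimating the random vector `X` from the observation `Y`: the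
mean-square error `E ‖X - E[X | Y]‖²` of the conditional mean, as an extended nonnegative real. -/
def mmse {Ω E F : Type*} [MeasurableSpace Ω] [NormedAddCommGroup E] [NormedSpace ℝ E]
    [CompleteSpace E] [mF : MeasurableSpace F] (P : Measure Ω) (X : Ω → E) (Y : Ω → F) : ℝ≥0∞ :=
  ∫⁻ ω, ‖X ω - (P[X | MeasurableSpace.comap Y mF]) ω‖ₑ ^ 2 ∂P

namespace JointGMM

variable {n₁ n₂ K₁ K₂ : ℕ} (M : JointGMM n₁ n₂ K₁ K₂)

/-- The set of class pairs of positive probability. -/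
def support : Set (Fin K₁ × Fin K₂) := {c | 0 < M.p c}

/-- `r_{x₁}`, the rank of the covariance matrix of `x₁` given the class pair. -/
def rank₁ (c : Fin K₁ × Fin K₂) : ℕ := (M.cov c).toBlocks₁₁.rank

/-- `r_{x₂}`, the rank of the covariance matrix of `x₂` given the class pair. -/
def rank₂ (c : Fin K₁ × Fin K₂) : ℕ := (M.cov c).toBlocks₂₂.rank

/-- `r_x`, the rank of the covariance matrix of `x = (x₁, x₂)` given the class pair. -/
def rank (c : Fin K₁ × Fin K₂) : ℕ := (M.cov c).rank

/-- The joint law of the class pair `(C₁, C₂)` and of `x = (x₁, x₂)`: the class pair has law `p`,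
and `x` is Gaussian given the class pair. -/
def sourceLaw : Measure ((Fin K₁ × Fin K₂) × EuclideanSpace ℝ (Fin n₁ ⊕ Fin n₂)) :=
  ∑ c, M.p c • (Measure.dirac c).prod (multivariateGaussian (M.mean c) (M.cov c))

/-- The joint law of `((C₁, C₂), x)` and of the noise `(w₁, w₂)`: the noise is independent of the
source, and `w₁ ∼ 𝒩(0, s I)` and `w₂ ∼ 𝒩(0, s I)` are independent. -/
def systemLaw (m₁ m₂ : ℕ) (s : ℝ) :
    Measure (((Fin K₁ × Fin K₂) × EuclideanSpace ℝ (Fin n₁ ⊕ Fin n₂)) ×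
      (EuclideanSpace ℝ (Fin m₁) × EuclideanSpace ℝ (Fin m₂))) :=
  M.sourceLaw.prod ((noiseLaw m₁ s).prod (noiseLaw m₂ s))

/-- The minimum mean-square error in estimating `x₁` from `y₁ = Φ₁ x₁ + w₁` and
`y₂ = Φ₂ x₂ + w₂`, for known kernels `Φ₁`, `Φ₂` and noise variance `s = σ²`. -/
def mmseSideInfo {m₁ m₂ : ℕ} (Φ₁ : Matrix (Fin m₁) (Fin n₁) ℝ) (Φ₂ : Matrix (Fin m₂) (Fin n₂) ℝ)
    (s : ℝ) : ℝ≥0∞ :=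
  mmse (M.systemLaw m₁ m₂ s) (fun ω => fstBlock ω.1.2)
    (fun ω => (observe Φ₁ (fstBlock ω.1.2) ω.2.1, observe Φ₂ (sndBlock ω.1.2) ω.2.2))

end JointGMM

end GMMSideInfo

end

/-! Write `V_c` for the linear span `gaussianSpace` of the centred Gaussian of class `c`, and `T`
for the noise-free map `sensing`.

It suffices that, for almost every pair of kernels, `x₁` is almost surely a measurable function `g`
of `T x`. Then `g` is approximated in L² by a bounded continuous `h`, continuity makes `h` robust to
vanishing noise, and the conditional mean does as well as `h` up to a constant
(`exists_boundedContinuous_estimator`, `mmse_le`).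

To build `g`, use on each affine set `T (μ_c + V_c)` the linear reconstruction of class `c`. The
class itself need not be identifiable. Let `U_c ⊇ V_c` be a subspace on which `T` determines the
first block. If the support of class `d` lies in `μ_c + U_c`, the reconstruction of `c` is also
correct for `d`. Otherwise `T` sends some point of that support outside `T (μ_c + V_c)`, and a
Gaussian does not charge proper affine subspaces of its support, so class `d` almost surely avoids
that region (`exists_measurable_recovery`).

The ranks enter through generic injectivity: a kernel with a density is almost surely injective on a
fixed subspace of dimension at most its number of rows. Strict inequalities leave room for one extra
vector, which is what separation from another class requires. If `m₁ > r_{x₁}`, `U_c` consists of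
all vectors whose first block lies in that of `V_c`; otherwise `U_c = V_c`, and the two kernels
share the dimension count (`ae_residual_subspace`). -/

namespace GMMSideInfo

open Module

/-! ### Generic injectivity in linear families of maps -/

section Generic

variable {E E' F : Type*} [NormedAddCommGroup E] [NormedSpace ℝ E] [FiniteDimensional ℝ E]
  [NormedAddCommGroup E'] [NormedSpace ℝ E']
  [NormedAddCommGroup F] [NormedSpace ℝ F] [FiniteDimensional ℝ F]

/-- Injectivity on a fixed subspace is an open condition in a linear family of linear maps. -/
theorem isOpen_disjoint_ker {G : Type*} [TopologicalSpace G] (T : G → E →ₗ[ℝ] E')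
    (hT : ∀ u, Continuous fun a => T a u) (U : Submodule ℝ E) :
    IsOpen {a | ∀ u ∈ U, T a u = 0 → u = 0} := by
  let b := finBasis ℝ U
  -- Injectivity on `U` is linear independence of the images of a basis, and independence of a
  -- finite family is an open condition.
  have key : {a | ∀ u ∈ U, T a u = 0 → u = 0} =
      (fun a => fun i => T a (b i : E)) ⁻¹' {f | LinearIndependent ℝ f} := by
    ext a
    have h1 : (fun i => T a (b i : E)) = (T a ∘ₗ U.subtype) ∘ b := by ext; simp
    rw [Set.mem_preimage, Set.mem_ofPred_eq, Set.mem_ofPred_eq, h1]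
    constructor
    · intro h
      refine b.linearIndependent.map' _ ?_
      rw [LinearMap.ker_eq_bot']
      intro u hu
      exact Subtype.ext (h u u.2 hu)
    · intro h u hu hz
      have h3 := Fintype.linearIndependent_iff.1 h (b.repr ⟨u, hu⟩) (by
        simp only [Function.comp_apply]
        simp_rw [← map_smul, ← map_sum, b.sum_repr]
        exact hz)
      have h4 : (⟨u, hu⟩ : U) = 0 := by
        rw [← b.sum_repr ⟨u, hu⟩]
        simp [h3]
      simpa using congrArg Subtype.val h4
  rw [key]
  exact isOpen_setOfPred_linearIndependent.preimage (continuous_pi fun i => hT _)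

/-- In a linear family of linear maps, injectivity on a subspace holds for almost every parameter
as soon as it holds for one. -/
theorem ae_disjoint_ker_of_exists [MeasurableSpace F] [BorelSpace F] (ν : Measure F)
    [ν.IsAddHaarMeasure] (T : F →ₗ[ℝ] E →ₗ[ℝ] E') (U : Submodule ℝ E) (a₀ : F)
    (h₀ : ∀ u ∈ U, T a₀ u = 0 → u = 0) :
    ∀ᵐ a ∂ν, ∀ u ∈ U, T a u = 0 → u = 0 := by
  have hcont : ∀ u, Continuous fun a => T a u := fun u =>
    (T.flip u).continuous_of_finiteDimensional
  obtain ⟨Q, hQ⟩ := LinearMap.exists_leftInverse_of_injective (T a₀ ∘ₗ U.subtype)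
    (LinearMap.ker_eq_bot'.2 fun u hu => Subtype.ext (h₀ u u.2 hu))
  -- Fubini along lines of direction `a₀`: if the map at `y + t • a₀` kills a nonzero `u` in `U`,
  -- applying `Q` gives `f u = -t • u`, so `-t` is one of the finitely many eigenvalues of `f`.
  refine ae_mem_of_ae_add_linearMap_mem ((LinearMap.id : ℝ →ₗ[ℝ] ℝ).smulRight a₀) volume ν
    (isOpen_disjoint_ker (fun a => T a) hcont U).measurableSet fun y => ?_
  let f : End ℝ U := Q ∘ₗ T y ∘ₗ U.subtype
  have hfin : (Neg.neg ⁻¹' {μ | f.HasEigenvalue μ}).Finite :=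
    (End.finite_hasEigenvalue f).preimage neg_injective.injOn
  filter_upwards [hfin.measure_zero volume |> compl_mem_ae_iff.2] with t ht u hu hz
  by_contra hne
  refine ht ?_
  refine End.hasEigenvalue_of_hasEigenvector (x := ⟨u, hu⟩) ⟨End.mem_eigenspace_iff.2 ?_, ?_⟩
  · have h1 : Q (T a₀ u) = ⟨u, hu⟩ := by simpa using LinearMap.congr_fun hQ ⟨u, hu⟩
    have h2 : T y u + t • T a₀ u = 0 := by simpa using hz
    have h3 : Q (T y u) + t • Q (T a₀ u) = 0 := by rw [← map_smul, ← map_add, h2, map_zero]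
    rw [h1] at h3
    simpa [f] using eq_neg_of_add_eq_zero_left h3
  · simpa [Subtype.ext_iff] using hne

end Generic

/-- A linear map that is injective on `U` exists whenever the dimension of `U` permits. -/
theorem exists_linearMap_disjoint_ker {E E' : Type*} [AddCommGroup E] [Module ℝ E]
    [FiniteDimensional ℝ E] [AddCommGroup E'] [Module ℝ E'] [FiniteDimensional ℝ E']
    (U : Submodule ℝ E) (hU : finrank ℝ U ≤ finrank ℝ E') :
    ∃ f : E →ₗ[ℝ] E', ∀ u ∈ U, f u = 0 → u = 0 := by
  let b := finBasis ℝ U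
  let f : U →ₗ[ℝ] E' := b.constr ℕ (finBasis ℝ E' ∘ Fin.castLE hU)
  have hf : Function.Injective f := b.injective_constr_of_linearIndependent
    ((finBasis ℝ E').linearIndependent.comp _ (Fin.castLE_injective hU))
  obtain ⟨g, hg⟩ := LinearMap.exists_extend f
  refine ⟨g, fun u hu hz => ?_⟩
  have h1 : g u = f ⟨u, hu⟩ := LinearMap.congr_fun hg ⟨u, hu⟩
  rw [hz] at h1
  simpa using congrArg Subtype.val (hf (h1.symm.trans (map_zero f).symm))

/-! ### Lebesgue-almost every matrix -/

variable {m n : ℕ}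

instance volume_pi_isAddHaarMeasure :
    (volume : Measure (Fin m → Fin n → ℝ)).IsAddHaarMeasure :=
  Measure.pi.isAddHaarMeasure _

theorem ae_matrix_disjoint_ker (U : Submodule ℝ (EuclideanSpace ℝ (Fin n)))
    (hU : finrank ℝ U ≤ m) :
    ∀ᵐ A : Matrix (Fin m) (Fin n) ℝ, ∀ u ∈ U, Matrix.toEuclideanLin A u = 0 → u = 0 := by
  obtain ⟨f, hf⟩ := exists_linearMap_disjoint_ker (E' := EuclideanSpace ℝ (Fin m)) U (by simpa)
  refine ae_disjoint_ker_of_exists (F := Fin m → Fin n → ℝ) volume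
    (Matrix.toEuclideanLin (𝕜 := ℝ) (m := Fin m) (n := Fin n)).toLinearMap U
    (Matrix.toEuclideanLin.symm f) ?_
  intro u hu h
  refine hf u hu ?_
  rw [← h]
  exact (LinearMap.congr_fun (Matrix.toEuclideanLin.apply_symm_apply f) u).symm

/-- A subspace of `U` of dimension exactly `m` is almost surely mapped injectively, hence onto by
counting dimensions. -/
theorem ae_matrix_map_eq_top (U : Submodule ℝ (EuclideanSpace ℝ (Fin n)))
    (hU : m ≤ finrank ℝ U) :
    ∀ᵐ A : Matrix (Fin m) (Fin n) ℝ, U.map (Matrix.toEuclideanLin A) = ⊤ := by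
  let b := finBasis ℝ U
  let v : Fin m → EuclideanSpace ℝ (Fin n) := fun i => b (Fin.castLE hU i)
  have hv : LinearIndependent ℝ v := by
    have := b.linearIndependent.map' U.subtype U.ker_subtype
    exact this.comp _ (Fin.castLE_injective hU)
  have hfin : finrank ℝ (Submodule.span ℝ (Set.range v)) = m := by
    simpa using finrank_span_eq_card hv
  have hle : Submodule.span ℝ (Set.range v) ≤ U := by
    rw [Submodule.span_le]
    rintro _ ⟨i, rfl⟩
    exact (b _).2
  filter_upwards [ae_matrix_disjoint_ker _ hfin.le] with A hA
  refine top_unique (le_trans ?_ (Submodule.map_mono hle))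
  refine (Submodule.eq_top_of_finrank_eq ?_).ge
  rw [← Submodule.range_subtype (Submodule.span ℝ (Set.range v)), ← LinearMap.range_comp,
    LinearMap.finrank_range_of_inj, hfin]
  · simp
  · exact LinearMap.ker_eq_bot.1 (LinearMap.ker_eq_bot'.2 fun u hu => Subtype.ext (hA u u.2 hu))

/-! ### Two-block sensing and its dimension count -/

variable {n₁ n₂ m₁ m₂ : ℕ}

/-- The projection `(x₁, x₂) ↦ x₁` as a linear map. -/
def fstₗ (n₁ n₂ : ℕ) : EuclideanSpace ℝ (Fin n₁ ⊕ Fin n₂) →ₗ[ℝ] EuclideanSpace ℝ (Fin n₁) where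
  toFun := fstBlock
  map_add' _ _ := rfl
  map_smul' _ _ := rfl

/-- The projection `(x₁, x₂) ↦ x₂` as a linear map. -/
def sndₗ (n₁ n₂ : ℕ) : EuclideanSpace ℝ (Fin n₁ ⊕ Fin n₂) →ₗ[ℝ] EuclideanSpace ℝ (Fin n₂) where
  toFun := sndBlock
  map_add' _ _ := rfl
  map_smul' _ _ := rfl

theorem eq_zero_of_blocks_eq_zero {x : EuclideanSpace ℝ (Fin n₁ ⊕ Fin n₂)}
    (h₁ : fstₗ n₁ n₂ x = 0) (h₂ : sndₗ n₁ n₂ x = 0) : x = 0 := by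
  ext i
  cases i with
  | inl a => exact congrArg (fun z => z.ofLp a) h₁
  | inr b => exact congrArg (fun z => z.ofLp b) h₂

/-- The noise-free observation `(x₁, x₂) ↦ (Φ₁ x₁, Φ₂ x₂)`. -/
noncomputable def sensing (Φ₁ : Matrix (Fin m₁) (Fin n₁) ℝ) (Φ₂ : Matrix (Fin m₂) (Fin n₂) ℝ) :
    EuclideanSpace ℝ (Fin n₁ ⊕ Fin n₂) →ₗ[ℝ]
      EuclideanSpace ℝ (Fin m₁) × EuclideanSpace ℝ (Fin m₂) :=
  (Matrix.toEuclideanLin Φ₁ ∘ₗ fstₗ n₁ n₂).prod (Matrix.toEuclideanLin Φ₂ ∘ₗ sndₗ n₁ n₂)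

/-- Rank-nullity for the restriction of a linear map to a subspace. -/
theorem finrank_map_add_finrank_inf_ker {E E' : Type*} [AddCommGroup E] [Module ℝ E]
    [FiniteDimensional ℝ E] [AddCommGroup E'] [Module ℝ E'] (f : E →ₗ[ℝ] E')
    (W : Submodule ℝ E) :
    finrank ℝ (W.map f) + finrank ℝ (W ⊓ LinearMap.ker f : Submodule ℝ E) = finrank ℝ W := by
  have h := LinearMap.finrank_range_add_finrank_ker (f.domRestrict W)
  have h1 : (W ⊓ LinearMap.ker f : Submodule ℝ E) =
      (LinearMap.ker (f.domRestrict W)).map W.subtype := by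
    ext x
    simp [and_comm]
  rw [h1, Submodule.finrank_map_subtype_eq, ← h, LinearMap.range_domRestrict]

/-- For almost every `Φ₁`, the vectors of `W` invisible to `Φ₁` form a subspace of dimension at
most `m₂` on which the second block is injective. -/
theorem ae_residual_subspace (W : Submodule ℝ (EuclideanSpace ℝ (Fin n₁ ⊕ Fin n₂)))
    (h : finrank ℝ W ≤ m₁ + m₂) (h₁ : finrank ℝ W ≤ m₁ + finrank ℝ (W.map (sndₗ n₁ n₂)))
    (h₂ : finrank ℝ W ≤ m₂ + finrank ℝ (W.map (fstₗ n₁ n₂))) :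
    ∀ᵐ A : Matrix (Fin m₁) (Fin n₁) ℝ,
      finrank ℝ (W ⊓ LinearMap.ker (Matrix.toEuclideanLin A ∘ₗ fstₗ n₁ n₂) : Submodule ℝ _) ≤ m₂ ∧
      ∀ w ∈ W, Matrix.toEuclideanLin A (fstₗ n₁ n₂ w) = 0 → sndₗ n₁ n₂ w = 0 → w = 0 := by
  -- Only vectors of `W` with zero second block matter for the injectivity claim; by rank-nullity
  -- and `h₁` they span at most `m₁` dimensions.
  let K := W ⊓ LinearMap.ker (sndₗ n₁ n₂)
  have hK : finrank ℝ (K.map (fstₗ n₁ n₂)) ≤ m₁ := by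
    have := finrank_map_add_finrank_inf_ker (sndₗ n₁ n₂) W
    have : finrank ℝ (K.map (fstₗ n₁ n₂)) ≤
      finrank ℝ (W ⊓ LinearMap.ker (sndₗ n₁ n₂) : Submodule ℝ _) := Submodule.finrank_map_le _ K
    omega
  refine Filter.Eventually.and ?_ ?_
  -- Either `A` is injective on the first block of `W` and the residual is the kernel of that
  -- projection, bounded through `h₂`; or `A` is onto and removes exactly `m₁` dimensions, bounded
  -- through `h`.
  · rcases le_total (finrank ℝ (W.map (fstₗ n₁ n₂))) m₁ with hm | hm
    · filter_upwards [ae_matrix_disjoint_ker _ hm] with A hA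
      have h3 := finrank_map_add_finrank_inf_ker (fstₗ n₁ n₂) W
      have h4 : (W ⊓ LinearMap.ker (Matrix.toEuclideanLin A ∘ₗ fstₗ n₁ n₂) : Submodule ℝ _) ≤
          W ⊓ LinearMap.ker (fstₗ n₁ n₂) := fun w hw =>
        ⟨hw.1, hA _ (Submodule.mem_map_of_mem hw.1) hw.2⟩
      have h5 := Submodule.finrank_mono h4
      omega
    · filter_upwards [ae_matrix_map_eq_top _ hm] with A hA
      have h3 := finrank_map_add_finrank_inf_ker (Matrix.toEuclideanLin A ∘ₗ fstₗ n₁ n₂) W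
      rw [Submodule.map_comp, hA, finrank_top, finrank_euclideanSpace_fin] at h3
      omega
  · filter_upwards [ae_matrix_disjoint_ker _ hK] with A hA w hw hz hz'
    exact eq_zero_of_blocks_eq_zero (hA _ (Submodule.mem_map_of_mem ⟨hw, hz'⟩) hz) hz'

instance : (volume : Measure (Matrix (Fin m₁) (Fin n₁) ℝ)).IsAddHaarMeasure :=
  volume_pi_isAddHaarMeasure

instance : SigmaFinite (volume : Measure (Matrix (Fin m₁) (Fin n₁) ℝ)) :=
  inferInstanceAs (SigmaFinite (volume : Measure (Fin m₁ → Fin n₁ → ℝ)))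

/-- By Fubini `A` is drawn first. The vectors it leaves invisible have dimension at most `m₂`, so a
generic `B` is injective on their second blocks, and these determine them. -/
theorem ae_prod_sensing_disjoint_ker (W : Submodule ℝ (EuclideanSpace ℝ (Fin n₁ ⊕ Fin n₂)))
    (h : finrank ℝ W ≤ m₁ + m₂) (h₁ : finrank ℝ W ≤ m₁ + finrank ℝ (W.map (sndₗ n₁ n₂)))
    (h₂ : finrank ℝ W ≤ m₂ + finrank ℝ (W.map (fstₗ n₁ n₂))) :
    ∀ᵐ A : Matrix (Fin m₁) (Fin n₁) ℝ × Matrix (Fin m₂) (Fin n₂) ℝ ∂(volume.prod volume),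
      ∀ w ∈ W, sensing A.1 A.2 w = 0 → w = 0 := by
  have hopen : IsOpen {A : (Fin m₁ → Fin n₁ → ℝ) × (Fin m₂ → Fin n₂ → ℝ) |
      ∀ w ∈ W, sensing A.1 A.2 w = 0 → w = 0} := by
    refine isOpen_disjoint_ker (fun A : (Fin m₁ → Fin n₁ → ℝ) × (Fin m₂ → Fin n₂ → ℝ) =>
      sensing A.1 A.2) (fun u => ?_) W
    let T₁ : (Fin m₁ → Fin n₁ → ℝ) →ₗ[ℝ] EuclideanSpace ℝ (Fin m₁) :=
      (Matrix.toEuclideanLin (𝕜 := ℝ) (m := Fin m₁) (n := Fin n₁)).toLinearMap.flip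
        (fstₗ n₁ n₂ u)
    have c₁ : Continuous T₁ := T₁.continuous_of_finiteDimensional
    let T₂ : (Fin m₂ → Fin n₂ → ℝ) →ₗ[ℝ] EuclideanSpace ℝ (Fin m₂) :=
      (Matrix.toEuclideanLin (𝕜 := ℝ) (m := Fin m₂) (n := Fin n₂)).toLinearMap.flip
        (sndₗ n₁ n₂ u)
    have c₂ : Continuous T₂ := T₂.continuous_of_finiteDimensional
    exact (c₁.comp continuous_fst).prodMk (c₂.comp continuous_snd)
  have hmeas : MeasurableSet {A : Matrix (Fin m₁) (Fin n₁) ℝ × Matrix (Fin m₂) (Fin n₂) ℝ |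
      ∀ w ∈ W, sensing A.1 A.2 w = 0 → w = 0} := hopen.measurableSet
  refine (Measure.ae_prod_mem_iff_ae_ae_mem hmeas).2 ?_
  filter_upwards [ae_residual_subspace W h h₁ h₂] with A ⟨hA, hA'⟩
  have hd := ae_matrix_disjoint_ker (m := m₂) (Submodule.map (sndₗ n₁ n₂)
      (W ⊓ LinearMap.ker (Matrix.toEuclideanLin A ∘ₗ fstₗ n₁ n₂)))
    ((Submodule.finrank_map_le _ _).trans hA)
  filter_upwards [hd] with B hB w hw hz
  have hz₁ : Matrix.toEuclideanLin A (fstₗ n₁ n₂ w) = 0 := congrArg Prod.fst hz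
  exact hA' w hw hz₁ (hB _ (Submodule.mem_map_of_mem ⟨hw, hz₁⟩) (congrArg Prod.snd hz))

variable {Ω : Type*} [MeasurableSpace Ω] {P : Measure Ω}
  {Φ₁ : Ω → Matrix (Fin m₁) (Fin n₁) ℝ} {Φ₂ : Ω → Matrix (Fin m₂) (Fin n₂) ℝ}

theorem IsLeftRotationInvariant.map_absolutelyContinuous
    (hΦ₁ : IsLeftRotationInvariant P Φ₁) : P.map Φ₁ ≪ volume := by
  obtain ⟨f, -, hf, -⟩ := hΦ₁
  rw [hf]
  exact withDensity_absolutelyContinuous _ _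

theorem toEuclideanLin_of_isIdentityKernel {A : Matrix (Fin m₂) (Fin n₂) ℝ}
    (hA : IsIdentityKernel A) {x : EuclideanSpace ℝ (Fin n₂)}
    (hx : Matrix.toEuclideanLin A x = 0) : x = 0 := by
  obtain ⟨rfl, hA⟩ := hA
  have : A = 1 := by
    ext a b
    rw [hA, Matrix.one_apply]
    simp [Fin.ext_iff]
  simpa [this] using hx

/-- Independence makes the joint law of two kernels with densities absolutely continuous. When `Φ₂`
is the identity the second block is seen exactly, so the second half of `ae_residual_subspace` is
enough. -/
theorem ae_sensing_disjoint_ker [IsProbabilityMeasure P] (hΦ₁_meas : Measurable Φ₁) (hΦ₂_meas : Measurable Φ₂)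
    (hΦ_indep : IndepFun Φ₁ Φ₂ P) (hΦ₁ : IsLeftRotationInvariant P Φ₁)
    (hΦ₂ : IsLeftRotationInvariant P Φ₂ ∨ ∀ ω, IsIdentityKernel (Φ₂ ω))
    (W : Submodule ℝ (EuclideanSpace ℝ (Fin n₁ ⊕ Fin n₂)))
    (h : finrank ℝ W ≤ m₁ + m₂) (h₁ : finrank ℝ W ≤ m₁ + finrank ℝ (W.map (sndₗ n₁ n₂)))
    (h₂ : finrank ℝ W ≤ m₂ + finrank ℝ (W.map (fstₗ n₁ n₂))) :
    ∀ᵐ ω ∂P, ∀ w ∈ W, sensing (Φ₁ ω) (Φ₂ ω) w = 0 → w = 0 := by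
  rcases hΦ₂ with hΦ₂ | hΦ₂
  · have hmap := (indepFun_iff_map_prod_eq_prod_map_map hΦ₁_meas.aemeasurable
      hΦ₂_meas.aemeasurable).1 hΦ_indep
    have hac : P.map (fun ω => (Φ₁ ω, Φ₂ ω)) ≪ volume.prod volume := by
      rw [hmap]
      exact hΦ₁.map_absolutelyContinuous.prod hΦ₂.map_absolutelyContinuous
    exact ae_of_ae_map (hΦ₁_meas.prodMk hΦ₂_meas).aemeasurable
      (hac.ae_le (ae_prod_sensing_disjoint_ker W h h₁ h₂))
  · have := ae_of_ae_map hΦ₁_meas.aemeasurable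
      (hΦ₁.map_absolutelyContinuous.ae_le (ae_residual_subspace W h h₁ h₂))
    filter_upwards [this] with ω hω w hw hz
    exact hω.2 w hw (congrArg Prod.fst hz)
      (toEuclideanLin_of_isIdentityKernel (hΦ₂ ω) (congrArg Prod.snd hz))

theorem ae_fst_disjoint_ker (hΦ₁_meas : Measurable Φ₁) (hΦ₁ : IsLeftRotationInvariant P Φ₁)
    (U : Submodule ℝ (EuclideanSpace ℝ (Fin n₁))) (hU : finrank ℝ U ≤ m₁) :
    ∀ᵐ ω ∂P, ∀ u ∈ U, Matrix.toEuclideanLin (Φ₁ ω) u = 0 → u = 0 :=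
  ae_of_ae_map hΦ₁_meas.aemeasurable
    (hΦ₁.map_absolutelyContinuous.ae_le (ae_matrix_disjoint_ker U hU))

/-! ### Supports of singular Gaussian vectors -/

section Gaussian

open scoped MatrixOrder

variable {ι : Type*} [Fintype ι] [DecidableEq ι]

/-- The linear span of the centred Gaussian vector with covariance matrix `S`. -/
noncomputable def gaussianSpace (S : Matrix ι ι ℝ) : Submodule ℝ (EuclideanSpace ℝ ι) :=
  LinearMap.range (Matrix.toEuclideanLin (CFC.sqrt S))

theorem finrank_range_toEuclideanLin {κ : Type*} [Fintype κ] (A : Matrix κ ι ℝ) :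
    finrank ℝ (LinearMap.range (Matrix.toEuclideanLin A)) = A.rank := by
  classical
  change finrank ℝ (LinearMap.range (Matrix.toLpLin 2 2 A)) = _
  rw [Matrix.toLpLin_eq_toLin, ← Matrix.rank_eq_finrank_range_toLin]

theorem sqrt_mul_transpose {S : Matrix ι ι ℝ} (hS : S.PosSemidef) :
    CFC.sqrt S * (CFC.sqrt S).transpose = S := by
  have h : (CFC.sqrt S).conjTranspose = CFC.sqrt S :=
    (CFC.sqrt_nonneg S).isSelfAdjoint
  rw [← Matrix.conjTranspose_eq_transpose_of_trivial, h, CFC.sqrt_mul_sqrt_self _ hS.nonneg]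

theorem finrank_gaussianSpace {S : Matrix ι ι ℝ} (hS : S.PosSemidef) :
    finrank ℝ (gaussianSpace S) = S.rank := by
  rw [gaussianSpace, finrank_range_toEuclideanLin]
  conv_rhs => rw [← sqrt_mul_transpose hS, Matrix.rank_self_mul_transpose]

theorem ae_sub_mem_gaussianSpace (μ : EuclideanSpace ℝ ι) (S : Matrix ι ι ℝ) :
    ∀ᵐ x ∂multivariateGaussian μ S, x - μ ∈ gaussianSpace S := by
  rw [multivariateGaussian, ae_map_iff (by fun_prop)]
  · refine ae_of_all _ fun z => ?_
    simp only [add_sub_cancel_left]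
    exact ⟨z, rfl⟩
  · exact ((gaussianSpace S).closed_of_finiteDimensional.preimage
      (continuous_id.sub continuous_const)).measurableSet

/-- A linear functional of a Gaussian vector does not hit a value that it misses at some point of
the affine support. -/
theorem ae_multivariateGaussian_ne (μ : EuclideanSpace ℝ ι) (S : Matrix ι ι ℝ)
    (L : EuclideanSpace ℝ ι →ₗ[ℝ] ℝ) (b : ℝ) {v : EuclideanSpace ℝ ι} (hv : v ∈ gaussianSpace S)
    (hb : L (μ + v) ≠ b) : ∀ᵐ x ∂multivariateGaussian μ S, L x ≠ b := by
  have hL : Continuous L := L.continuous_of_finiteDimensional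
  rw [multivariateGaussian, ae_map_iff (by fun_prop)]
  swap
  · exact ((isClosed_singleton (x := b)).preimage hL).measurableSet.compl
  let R := Matrix.toEuclideanCLM (𝕜 := ℝ) (CFC.sqrt S)
  let N : StrongDual ℝ (EuclideanSpace ℝ ι) := (LinearMap.toContinuousLinearMap L).comp R
  have hN : ∀ z, L (μ + R z) = L μ + N z := fun z => map_add L _ _
  -- If `N = 0`, then `L` is constant on the affine support, with a value other than `b`. Otherwise
  -- `L x` is a nondegenerate real Gaussian, which has no atoms.
  by_cases h0 : N = 0
  · obtain ⟨z, rfl⟩ := hv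
    refine ae_of_all _ fun z' => ?_
    have h1 := hN z
    have h2 := hN z'
    rw [h0] at h1 h2
    exact fun h => hb (h1.trans (h2.symm.trans h))
  · have hlaw := IsGaussian.map_eq_gaussianReal (μ := stdGaussian (EuclideanSpace ℝ ι)) N
    rw [variance_dual_stdGaussian] at hlaw
    have hv : (‖N‖ ^ 2).toNNReal ≠ 0 := by
      have : 0 < ‖N‖ := norm_pos_iff.2 h0
      simp only [ne_eq, Real.toNNReal_eq_zero, not_le]
      positivity
    have := nullSingletonClass_gaussianReal (μ := (stdGaussian (EuclideanSpace ℝ ι))[N]) hv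
    rw [← hlaw] at this
    have hne : ∀ᵐ t ∂(stdGaussian (EuclideanSpace ℝ ι)).map N, t ≠ b - L μ :=
      compl_mem_ae_iff.2 (measure_singleton _)
    filter_upwards [ae_of_ae_map N.continuous.aemeasurable hne] with z hz h
    exact hz (eq_sub_of_add_eq' ((hN z).symm.trans h))

end Gaussian

/-! ### Exact recovery without noise -/

section Recovery

/-- `f` factors linearly through `T` on `V` if `T` separates what `f` separates. -/
theorem exists_linearMap_comp_eq {E F G : Type*} [AddCommGroup E] [Module ℝ E] [AddCommGroup F]
    [Module ℝ F] [AddCommGroup G] [Module ℝ G] (T : E →ₗ[ℝ] F) (f : E →ₗ[ℝ] G)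
    (V : Submodule ℝ E) (h : ∀ v ∈ V, T v = 0 → f v = 0) :
    ∃ R : F →ₗ[ℝ] G, ∀ v ∈ V, R (T v) = f v := by
  obtain ⟨s, hs⟩ := LinearMap.exists_rightInverse_of_surjective (T.domRestrict V).rangeRestrict
    (LinearMap.range_rangeRestrict _)
  obtain ⟨R, hR⟩ := LinearMap.exists_extend (f ∘ₗ V.subtype ∘ₗ s)
  refine ⟨R, fun v hv => ?_⟩
  let y : LinearMap.range (T.domRestrict V) := ⟨T v, ⟨v, hv⟩, rfl⟩
  have h1 : R (T v) = f (s y) := LinearMap.congr_fun hR y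
  have h2 : T (s y) = T v := congrArg Subtype.val (LinearMap.congr_fun hs y)
  have h3 := h (s y - v) (V.sub_mem (s y).2 hv) (by rw [map_sub, h2, sub_self])
  rw [h1]
  rwa [map_sub, sub_eq_zero] at h3

/-- Estimators that are valid on overlapping regions glue to a measurable one. -/
theorem exists_measurable_glue {X Y Z ι : Type*} [MeasurableSpace Y] [MeasurableSpace Z] [Nonempty Z]
    [DecidableEq ι] (T : X → Y) (f : X → Z) (B : ι → Set Y) (hB : ∀ c, MeasurableSet (B c))
    (g : ι → Y → Z) (hg : ∀ c, Measurable (g c)) (S : Finset ι) :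
    ∃ G : Y → Z, Measurable G ∧ ∀ x, (∀ c ∈ S, T x ∈ B c → g c (T x) = f x) →
      (∃ c ∈ S, T x ∈ B c) → G (T x) = f x := by
  classical
  induction S using Finset.induction_on with
  | empty => exact ⟨fun _ => Classical.arbitrary Z, measurable_const, by simp⟩
  | insert c S _ ih =>
    obtain ⟨G, hG, hGx⟩ := ih
    refine ⟨(B c).piecewise (g c) G, (hg c).piecewise (hB c) hG, fun x hx hx' => ?_⟩
    by_cases hc : T x ∈ B c
    · rw [Set.piecewise_eq_of_mem _ _ _ hc]
      exact hx c (Finset.mem_insert_self _ _) hc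
    · rw [Set.piecewise_eq_of_notMem _ _ _ hc]
      refine hGx x (fun c' hc' => hx c' (Finset.mem_insert_of_mem hc')) ?_
      obtain ⟨c', hc', hmem⟩ := hx'
      rcases Finset.mem_insert.1 hc' with rfl | h
      · exact absurd hmem hc
      · exact ⟨c', h, hmem⟩

/-- Noise-free recovery of a linear function `f x` of a Gaussian mixture from `T x`. -/
theorem exists_measurable_recovery {ι κ F G : Type*} [Fintype ι] [DecidableEq ι] [DecidableEq κ]
    [NormedAddCommGroup F] [NormedSpace ℝ F] [FiniteDimensional ℝ F] [MeasurableSpace F]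
    [BorelSpace F] [NormedAddCommGroup G] [NormedSpace ℝ G] [FiniteDimensional ℝ G]
    [MeasurableSpace G] [BorelSpace G]
    (μ : κ → EuclideanSpace ℝ ι) (S : κ → Matrix ι ι ℝ) (T : EuclideanSpace ℝ ι →ₗ[ℝ] F)
    (f : EuclideanSpace ℝ ι →ₗ[ℝ] G) (C : Finset κ) (U : κ → Submodule ℝ (EuclideanSpace ℝ ι))
    (hU : ∀ c ∈ C, gaussianSpace (S c) ≤ U c)
    (hT : ∀ c ∈ C, ∀ v ∈ U c, T v = 0 → f v = 0)
    (hsep : ∀ c ∈ C, ∀ d ∈ C, (∀ v ∈ gaussianSpace (S d), μ d + v - μ c ∈ U c) ∨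
      ∃ v ∈ gaussianSpace (S d), T (μ d + v - μ c) ∉ (gaussianSpace (S c)).map T) :
    ∃ g : F → G, Measurable g ∧ ∀ d ∈ C, ∀ᵐ x ∂multivariateGaussian (μ d) (S d), g (T x) = f x := by
  have hR : ∀ c, ∃ R : F →ₗ[ℝ] G, c ∈ C → ∀ v ∈ gaussianSpace (S c), R (T v) = f v := by
    intro c
    by_cases hc : c ∈ C
    · obtain ⟨R, hR⟩ := exists_linearMap_comp_eq T f _ (fun v hv => hT c hc v (hU c hc hv))
      exact ⟨R, fun _ => hR⟩
    · exact ⟨0, fun h => absurd h hc⟩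
  choose R hR using hR
  -- `B c` is the image under `T` of the affine support of class `c`; the reconstruction of class
  -- `c` is used there.
  let B : κ → Set F := fun c => {y | y - T (μ c) ∈ (gaussianSpace (S c)).map T}
  have hB : ∀ c, MeasurableSet (B c) := fun c =>
    (((gaussianSpace (S c)).map T).closed_of_finiteDimensional.preimage
      (continuous_id.sub continuous_const)).measurableSet
  obtain ⟨g, hg, hgx⟩ := exists_measurable_glue T f B hB
    (fun c y => f (μ c) + R c (y - T (μ c)))
    (fun c => by
      have := (R c).continuous_of_finiteDimensional
      exact Continuous.measurable (by fun_prop)) C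
  refine ⟨g, hg, fun d hd => ?_⟩
  have hself := ae_sub_mem_gaussianSpace (μ d) (S d)
  have hpair : ∀ c ∈ C, ∀ᵐ x ∂multivariateGaussian (μ d) (S d),
      T x ∈ B c → f (μ c) + R c (T x - T (μ c)) = f x := by
    intro c hc
    rcases hsep c hc d hd with h | ⟨v, hv, hTv⟩
    · filter_upwards [hself] with x hx hxB
      obtain ⟨w, hw, hwx⟩ := hxB
      have h1 : x - μ c ∈ U c := by simpa using h _ hx
      -- `x - μ c` and `w` have the same image under `T` and both lie in `U c`, so `f` agrees on
      -- them although `x` comes from class `d`.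
      have h2 := hT c hc (x - μ c - w) ((U c).sub_mem h1 (hU c hc hw))
        (by rw [map_sub, map_sub, hwx, sub_self])
      rw [← hwx, hR c hc w hw]
      rw [map_sub, map_sub, sub_eq_zero] at h2
      rw [← h2, add_sub_cancel]
    -- The functional `ℓ` is constant on `B c` and takes another value at one image point of class
    -- `d`, so class `d` almost surely misses `B c`.
    · obtain ⟨ℓ, hℓ, hker⟩ := Submodule.exists_le_ker_of_notMem hTv
      have h1 : (ℓ ∘ₗ T) (μ d + v) ≠ ℓ (T (μ c)) := by
        intro h
        apply hℓ
        rw [map_sub T, map_sub ℓ, sub_eq_zero]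
        exact h
      filter_upwards [ae_multivariateGaussian_ne (μ d) (S d) _ _ hv h1] with x hx hxB
      have h2 : ℓ (T x - T (μ c)) = 0 := hker hxB
      rw [map_sub, sub_eq_zero] at h2
      exact absurd h2 hx
  filter_upwards [hself, (Finset.eventually_all C).2 hpair] with x hx hx'
  refine hgx x hx' ⟨d, hd, ?_⟩
  exact ⟨x - μ d, hx, map_sub _ _ _⟩

end Recovery

/-! ### Mean-square error and continuous estimators -/

section MeanSquare

variable {Ω E F : Type*} [NormedAddCommGroup E]

theorem eLpNorm_two_sq [MeasurableSpace Ω] (Q : Measure Ω) (X : Ω → E) :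
    eLpNorm X 2 Q ^ 2 = ∫⁻ ω, ‖X ω‖ₑ ^ 2 ∂Q := by
  have := eLpNorm_nnreal_pow_eq_lintegral (f := X) (μ := Q) (p := 2) (by norm_num)
  simpa using this

/-- Up to a constant, the conditional mean is at least as good as any other estimator. -/
theorem mmse_le [InnerProductSpace ℝ E] [CompleteSpace E] [MeasurableSpace E] [BorelSpace E]
    [SecondCountableTopology E] [mF : MeasurableSpace F] {mΩ : MeasurableSpace Ω}
    {Q : Measure Ω} [IsFiniteMeasure Q] {X : Ω → E} {Y : Ω → F} (hX : MemLp X 2 Q) (hY : Measurable Y) {h : F → E} (hh : Measurable h)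
    (hhY : MemLp (h ∘ Y) 2 Q) :
    mmse Q X Y ≤ 4 * ∫⁻ ω, ‖X ω - h (Y ω)‖ₑ ^ 2 ∂Q := by
  have hm : MeasurableSpace.comap Y mF ≤ mΩ := hY.comap_le
  have hXi := hX.integrable one_le_two
  have hhi := hhY.integrable one_le_two
  have hcond : Q[h ∘ Y | mF.comap Y] = h ∘ Y :=
    condExp_of_stronglyMeasurable hm
      (hh.comp (comap_measurable Y)).stronglyMeasurable hhi
  have hsub : Q[X - h ∘ Y | mF.comap Y] =ᵐ[Q] Q[X | mF.comap Y] - h ∘ Y := by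
    have := condExp_sub hXi hhi (mF.comap Y)
    rwa [hcond] at this
  have hae : X - Q[X | mF.comap Y] =ᵐ[Q] (X - h ∘ Y) - Q[X - h ∘ Y | mF.comap Y] := by
    filter_upwards [hsub] with ω hω
    simp [hω]
  -- The triangle inequality and L² contractivity of conditional expectation give the factor 2,
  -- hence 4 after squaring; this crude constant is harmless in the limit.
  have hle : eLpNorm (X - Q[X | mF.comap Y]) 2 Q ≤ 2 * eLpNorm (X - h ∘ Y) 2 Q := by
    rw [eLpNorm_congr_ae hae, two_mul]
    refine (eLpNorm_sub_le (hX.sub hhY).1 integrable_condExp.1 one_le_two).trans ?_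
    gcongr
    exact eLpNorm_condExp_le_eLpNorm _ one_le_two
  calc mmse Q X Y = eLpNorm (X - Q[X | mF.comap Y]) 2 Q ^ 2 := (eLpNorm_two_sq _ _).symm
    _ ≤ (2 * eLpNorm (X - h ∘ Y) 2 Q) ^ 2 := by gcongr
    _ = 4 * ∫⁻ ω, ‖X ω - h (Y ω)‖ₑ ^ 2 ∂Q := by
      rw [mul_pow, eLpNorm_two_sq]
      norm_num

/-- If `X` is a function of `Z`, then a bounded continuous estimator has small mean-square error
at low noise. -/
theorem exists_boundedContinuous_estimator [MeasurableSpace Ω] [NormedSpace ℝ E] [MeasurableSpace E]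
    [BorelSpace E] [SecondCountableTopology E] [NormedAddCommGroup F] [NormedSpace ℝ F]
    [MeasurableSpace F] [BorelSpace F] [SecondCountableTopology F] {Q : Measure Ω}
    [IsFiniteMeasure Q] {X : Ω → E} {Z W : Ω → F} {g : F → E} (hX : Measurable X)
    (hX₂ : MemLp X 2 Q) (hZ : Measurable Z) (hW : Measurable W) (hg : Measurable g)
    (hgZ : ∀ᵐ ω ∂Q, g (Z ω) = X ω) {ε : ℝ≥0∞} (hε : ε ≠ 0) :
    ∃ h : BoundedContinuousFunction F E,
      ∀ᶠ s in 𝓝[>] (0 : ℝ), ∫⁻ ω, ‖X ω - h (Z ω + √s • W ω)‖ₑ ^ 2 ∂Q ≤ ε := by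
  -- The noise-free error is made at most `δ`, strictly below `ε`, so that the limit in `s` stays
  -- under `ε` eventually.
  obtain ⟨δ, hδ, hδε⟩ := exists_between (pos_iff_ne_zero.2 hε)
  have hgL : MemLp g 2 (Q.map Z) :=
    (memLp_map_measure_iff hg.aestronglyMeasurable hZ.aemeasurable).2
      (hX₂.ae_eq (hgZ.mono fun ω hω => hω.symm))
  obtain ⟨h, hh, -⟩ := hgL.exists_boundedContinuous_eLpNorm_sub_le (by norm_num)
    (ε := δ ^ (1 / 2 : ℝ)) (by simp [hδ.ne'])
  refine ⟨h, ?_⟩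
  have hsmall : ∫⁻ ω, ‖X ω - h (Z ω)‖ₑ ^ 2 ∂Q ≤ δ := by
    calc ∫⁻ ω, ‖X ω - h (Z ω)‖ₑ ^ 2 ∂Q = ∫⁻ ω, ‖(g - ⇑h) (Z ω)‖ₑ ^ 2 ∂Q := by
          refine lintegral_congr_ae (hgZ.mono fun ω hω => ?_)
          simp [hω]
      _ = ∫⁻ z, ‖(g - ⇑h) z‖ₑ ^ 2 ∂(Q.map Z) := by
          rw [lintegral_map _ hZ]
          exact ((hg.sub h.continuous.measurable).enorm.pow_const 2)
      _ = eLpNorm (g - ⇑h) 2 (Q.map Z) ^ 2 := (eLpNorm_two_sq _ _).symm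
      _ ≤ (δ ^ (1 / 2 : ℝ)) ^ 2 := by gcongr
      _ = δ := by
          rw [← ENNReal.rpow_natCast, ← ENNReal.rpow_mul]
          norm_num
  have hlim : Tendsto (fun s : ℝ => ∫⁻ ω, ‖X ω - h (Z ω + √s • W ω)‖ₑ ^ 2 ∂Q) (𝓝[>] 0)
      (𝓝 (∫⁻ ω, ‖X ω - h (Z ω)‖ₑ ^ 2 ∂Q)) := by
    refine tendsto_lintegral_filter_of_dominated_convergence
      (fun ω => ‖‖X ω‖ + ‖h‖‖ₑ ^ 2) (Eventually.of_forall fun s => ?_)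
      (Eventually.of_forall fun s => ae_of_all _ fun ω => ?_) ?_ (ae_of_all _ fun ω => ?_)
    · exact (hX.sub (h.continuous.measurable.comp (hZ.add (hW.const_smul _)))).enorm.pow_const 2
    · gcongr
      rw [enorm_le_iff_norm_le, Real.norm_of_nonneg (by positivity)]
      exact (norm_sub_le _ _).trans (by gcongr; exact h.norm_coe_le_norm _)
    · rw [← eLpNorm_two_sq]
      exact ENNReal.pow_ne_top (hX₂.norm.add (memLp_const _)).2.ne
    · have hc : Continuous fun s : ℝ => ‖X ω - h (Z ω + √s • W ω)‖ₑ ^ 2 := by fun_prop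
      have := (hc.tendsto 0).mono_left (nhdsWithin_le_nhds (s := Set.Ioi 0))
      simpa using this
  exact (hlim.eventually (gt_mem_nhds (hsmall.trans_lt hδε))).mono fun s hs => hs.le

end MeanSquare

/-! ### Rescaling the noise and the low-noise limit -/

section Noise

open scoped MatrixOrder

/-- Rescaled white noise. -/
theorem noiseLaw_eq_map (m : ℕ) {s : ℝ} (hs : 0 ≤ s) :
    noiseLaw m s = (noiseLaw m 1).map (fun w => √s • w) := by
  have h : CFC.sqrt (s • (1 : Matrix (Fin m) (Fin m) ℝ)) = √s • 1 := by
    refine CFC.sqrt_unique ?_ ?_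
    · rw [smul_mul_smul_comm, Real.mul_self_sqrt hs, mul_one]
    · exact (Matrix.PosSemidef.one.smul (Real.sqrt_nonneg s)).nonneg
  rw [noiseLaw, noiseLaw, one_smul, multivariateGaussian_zero_one, multivariateGaussian, h]
  congr 1
  ext x : 1
  simp

instance (m : ℕ) (s : ℝ) : IsProbabilityMeasure (noiseLaw m s) :=
  inferInstanceAs (IsProbabilityMeasure (multivariateGaussian _ _))

namespace JointGMM

variable {n₁ n₂ K₁ K₂ m₁ m₂ : ℕ} (M : JointGMM n₁ n₂ K₁ K₂)

instance : IsProbabilityMeasure M.sourceLaw where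
  measure_univ := by
    have := M.p.tsum_coe
    rw [tsum_fintype] at this
    simpa [sourceLaw] using this

/-- This moves the dependence on `s` from the measure to the integrand, so dominated convergence
applies on one fixed probability space. -/
theorem systemLaw_eq_map {s : ℝ} (hs : 0 ≤ s) :
    M.systemLaw m₁ m₂ s = (M.systemLaw m₁ m₂ 1).map (fun ω => (ω.1, √s • ω.2)) := by
  have h₁ : Measurable fun w : EuclideanSpace ℝ (Fin m₁) => √s • w := by fun_prop
  have h₂ : Measurable fun w : EuclideanSpace ℝ (Fin m₂) => √s • w := by fun_prop
  have h : Measurable (Prod.map (fun w : EuclideanSpace ℝ (Fin m₁) => √s • w)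
    (fun w : EuclideanSpace ℝ (Fin m₂) => √s • w)) := h₁.prodMap h₂
  rw [systemLaw, noiseLaw_eq_map m₁ hs, noiseLaw_eq_map m₂ hs, Measure.map_prod_map _ _ h₁ h₂]
  conv_lhs => rw [← Measure.map_id (μ := M.sourceLaw)]
  rw [Measure.map_prod_map _ _ measurable_id h]
  rfl

instance (s : ℝ) : IsProbabilityMeasure (M.systemLaw m₁ m₂ s) :=
  inferInstanceAs (IsProbabilityMeasure (M.sourceLaw.prod ((noiseLaw m₁ s).prod (noiseLaw m₂ s))))

theorem ae_sourceLaw {q : EuclideanSpace ℝ (Fin n₁ ⊕ Fin n₂) → Prop}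
    (hq : MeasurableSet {x | q x})
    (h : ∀ c ∈ M.support, ∀ᵐ x ∂multivariateGaussian (M.mean c) (M.cov c), q x) :
    ∀ᵐ z ∂M.sourceLaw, q z.2 := by
  rw [sourceLaw, ae_finsetSum_measure_iff]
  intro c _
  by_cases hc : M.p c = 0
  · simp [hc]
  · refine Measure.ae_smul_measure ?_ _
    have hq' : MeasurableSet {z : (Fin K₁ × Fin K₂) × _ | q z.2} := measurable_snd hq
    rw [Measure.dirac_prod, ae_map_iff (by fun_prop) hq']
    exact h c (pos_iff_ne_zero.2 hc)

theorem memLp_fstBlock : MemLp (fun z => fstBlock z.2) 2 M.sourceLaw := by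
  have hc : Continuous (fstₗ n₁ n₂) := (fstₗ n₁ n₂).continuous_of_finiteDimensional
  have hm : Measurable fun z : (Fin K₁ × Fin K₂) × EuclideanSpace ℝ (Fin n₁ ⊕ Fin n₂) =>
    fstBlock z.2 := hc.measurable.comp measurable_snd
  refine ⟨hm.aestronglyMeasurable, ?_⟩
  refine (ENNReal.pow_lt_top_iff (n := 2)).1 ?_ |>.resolve_right two_ne_zero
  rw [eLpNorm_two_sq, sourceLaw, lintegral_finsetSum_measure,
    ENNReal.sum_lt_top]
  intro c _
  rw [lintegral_smul_measure, Measure.dirac_prod, lintegral_map (by fun_prop) (by fun_prop)]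
  refine ENNReal.mul_lt_top (M.p.apply_lt_top c) ?_
  have h1 : MemLp (fun x => fstₗ n₁ n₂ x) 2 (multivariateGaussian (M.mean c) (M.cov c)) :=
    (LinearMap.toContinuousLinearMap (fstₗ n₁ n₂)).comp_memLp' IsGaussian.memLp_two_id
  have h2 := eLpNorm_two_sq (multivariateGaussian (M.mean c) (M.cov c)) (fun x => fstₗ n₁ n₂ x)
  exact h2 ▸ ENNReal.pow_lt_top h1.2

/-- If `x₁` is almost surely a function of the noise-free observation, the minimum mean-square
error vanishes at low noise. -/
theorem tendsto_mmseSideInfo (Φ₁ : Matrix (Fin m₁) (Fin n₁) ℝ) (Φ₂ : Matrix (Fin m₂) (Fin n₂) ℝ)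
    {g : EuclideanSpace ℝ (Fin m₁) × EuclideanSpace ℝ (Fin m₂) → EuclideanSpace ℝ (Fin n₁)}
    (hg : Measurable g) (h : ∀ c ∈ M.support,
      ∀ᵐ x ∂multivariateGaussian (M.mean c) (M.cov c), g (sensing Φ₁ Φ₂ x) = fstₗ n₁ n₂ x) :
    Tendsto (fun s : ℝ => M.mmseSideInfo Φ₁ Φ₂ s) (𝓝[>] 0) (𝓝 0) := by
  have hf : Measurable (fstₗ n₁ n₂) := (fstₗ n₁ n₂).continuous_of_finiteDimensional.measurable
  have hT : Measurable (sensing Φ₁ Φ₂) := (sensing Φ₁ Φ₂).continuous_of_finiteDimensional.measurable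
  let X : ((Fin K₁ × Fin K₂) × EuclideanSpace ℝ (Fin n₁ ⊕ Fin n₂)) ×
      (EuclideanSpace ℝ (Fin m₁) × EuclideanSpace ℝ (Fin m₂)) → EuclideanSpace ℝ (Fin n₁) :=
    fun ω => fstₗ n₁ n₂ ω.1.2
  let Z : ((Fin K₁ × Fin K₂) × EuclideanSpace ℝ (Fin n₁ ⊕ Fin n₂)) ×
      (EuclideanSpace ℝ (Fin m₁) × EuclideanSpace ℝ (Fin m₂)) → _ :=
    fun ω => sensing Φ₁ Φ₂ ω.1.2
  have hX : Measurable X := by fun_prop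
  have hZ : Measurable Z := by fun_prop
  have hX₂ : ∀ s, MemLp X 2 (M.systemLaw m₁ m₂ s) := fun s => M.memLp_fstBlock.comp_fst _
  have hae : ∀ᵐ ω ∂M.systemLaw m₁ m₂ 1, g (Z ω) = X ω := by
    have := M.ae_sourceLaw (measurableSet_eq_fun (hg.comp hT) hf) h
    exact Measure.quasiMeasurePreserving_fst.ae this
  rw [ENNReal.tendsto_nhds_zero]
  intro ε hε
  obtain ⟨η, hb⟩ := exists_boundedContinuous_estimator hX (hX₂ 1) hZ measurable_snd hg hae
    (ε := ε / 4) (ENNReal.div_pos hε.ne' (by norm_num)).ne'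
  filter_upwards [hb, self_mem_nhdsWithin] with s hs hs0
  have hY : Measurable fun ω => Z ω + ω.2 := hZ.add measurable_snd
  have hη : Measurable η := η.continuous.measurable
  calc M.mmseSideInfo Φ₁ Φ₂ s
      ≤ 4 * ∫⁻ ω, ‖X ω - η (Z ω + ω.2)‖ₑ ^ 2 ∂M.systemLaw m₁ m₂ s :=
        mmse_le (hX₂ s) hY hη (MemLp.of_bound (hη.comp hY).aestronglyMeasurable ‖η‖
          (ae_of_all _ fun ω => η.norm_coe_le_norm _))
    _ = 4 * ∫⁻ ω, ‖X ω - η (Z ω + √s • ω.2)‖ₑ ^ 2 ∂M.systemLaw m₁ m₂ 1 := by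
        rw [M.systemLaw_eq_map (le_of_lt hs0), lintegral_map]
        · exact (hX.sub (hη.comp hY)).enorm.pow_const 2
        · fun_prop
    _ ≤ 4 * (ε / 4) := by gcongr
    _ = ε := ENNReal.mul_div_cancel (by norm_num) (by norm_num)

end JointGMM

end Noise

/-! ### Covariance ranks as dimensions of block projections -/

section Ranks

open scoped MatrixOrder

/-- A principal block of `S` is `R * Rᵀ`, where `R` consists of the corresponding rows of the square
root, and `R * Rᵀ` has the rank of `R`. -/
theorem rank_submatrix_eq_rank_sqrt_submatrix {ι κ : Type*} [Fintype ι] [DecidableEq ι] [Fintype κ]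
    {S : Matrix ι ι ℝ} (hS : S.PosSemidef) (e : κ → ι) :
    (S.submatrix e e).rank = ((CFC.sqrt S).submatrix e id).rank := by
  rw [← Matrix.rank_self_mul_transpose ((CFC.sqrt S).submatrix e id), Matrix.transpose_submatrix,
    ← Matrix.submatrix_mul _ _ _ _ _ Function.bijective_id, sqrt_mul_transpose hS]

variable {n₁ n₂ : ℕ} {S : Matrix (Fin n₁ ⊕ Fin n₂) (Fin n₁ ⊕ Fin n₂) ℝ}

theorem finrank_gaussianSpace_map_fst (hS : S.PosSemidef) :
    finrank ℝ ((gaussianSpace S).map (fstₗ n₁ n₂)) = S.toBlocks₁₁.rank := by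
  rw [show S.toBlocks₁₁ = S.submatrix Sum.inl Sum.inl from rfl,
    rank_submatrix_eq_rank_sqrt_submatrix hS, ← finrank_range_toEuclideanLin, gaussianSpace,
    ← LinearMap.range_comp]
  rfl

theorem finrank_gaussianSpace_map_snd (hS : S.PosSemidef) :
    finrank ℝ ((gaussianSpace S).map (sndₗ n₁ n₂)) = S.toBlocks₂₂.rank := by
  rw [show S.toBlocks₂₂ = S.submatrix Sum.inr Sum.inr from rfl,
    rank_submatrix_eq_rank_sqrt_submatrix hS, ← finrank_range_toEuclideanLin, gaussianSpace,
    ← LinearMap.range_comp]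
  rfl

end Ranks

/-! ### Recovery and separation for a single class -/

theorem finrank_sup_span_singleton_le {E : Type*} [AddCommGroup E] [Module ℝ E]
    [FiniteDimensional ℝ E] (V : Submodule ℝ E) (u : E) :
    finrank ℝ (V ⊔ Submodule.span ℝ {u} : Submodule ℝ E) ≤ finrank ℝ V + 1 := by
  refine (Submodule.finrank_add_le_finrank_add_finrank _ _).trans ?_
  gcongr
  simpa using finrank_span_le_card (R := ℝ) ({u} : Set E)

variable {Ω : Type*} [MeasurableSpace Ω] {P : Measure Ω} {n₁ n₂ m₁ m₂ : ℕ}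
  {Φ₁ : Ω → Matrix (Fin m₁) (Fin n₁) ℝ} {Φ₂ : Ω → Matrix (Fin m₂) (Fin n₂) ℝ}

/-- If the first kernel alone has more rows than the dimension of the first block of `V`, it
recovers the first block, and separates `V` from every vector whose first block is not in that of
`V`. -/
theorem ae_separation_of_fst (hΦ₁_meas : Measurable Φ₁) (hΦ₁ : IsLeftRotationInvariant P Φ₁)
    (V : Submodule ℝ (EuclideanSpace ℝ (Fin n₁ ⊕ Fin n₂)))
    (hV : finrank ℝ (V.map (fstₗ n₁ n₂)) < m₁) :
    (∀ᵐ ω ∂P, ∀ v ∈ (V.map (fstₗ n₁ n₂)).comap (fstₗ n₁ n₂),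
      sensing (Φ₁ ω) (Φ₂ ω) v = 0 → fstₗ n₁ n₂ v = 0) ∧
    ∀ u ∉ (V.map (fstₗ n₁ n₂)).comap (fstₗ n₁ n₂),
      ∀ᵐ ω ∂P, sensing (Φ₁ ω) (Φ₂ ω) u ∉ V.map (sensing (Φ₁ ω) (Φ₂ ω)) := by
  refine ⟨?_, fun u hu => ?_⟩
  · filter_upwards [ae_fst_disjoint_ker hΦ₁_meas hΦ₁ _ hV.le] with ω hω v hv hz
    exact hω _ hv (congrArg Prod.fst hz)
  -- The strict inequality `hV` pays for adjoining the first block of `u`.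
  · filter_upwards [ae_fst_disjoint_ker hΦ₁_meas hΦ₁ _
      ((finrank_sup_span_singleton_le (V.map (fstₗ n₁ n₂)) (fstₗ n₁ n₂ u)).trans hV)]
      with ω hω ⟨v, hv, hvu⟩
    have h1 : fstₗ n₁ n₂ v ∈ V.map (fstₗ n₁ n₂) := Submodule.mem_map_of_mem hv
    have h2 := hω (fstₗ n₁ n₂ v - fstₗ n₁ n₂ u)
      (Submodule.sub_mem _ (Submodule.mem_sup_left h1)
        (Submodule.mem_sup_right (Submodule.mem_span_singleton_self _)))
      (by rw [map_sub, sub_eq_zero]; exact congrArg Prod.fst hvu)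
    rw [sub_eq_zero] at h2
    exact hu (by rw [Submodule.mem_comap, ← h2]; exact h1)

/-- If both kernels together have more rows than the dimension of `V`, and the first one has more
rows than the dimension that the second block leaves undetermined but no more than that of the first
block, then they recover all of `V` and separate it from every other vector. -/
theorem ae_separation_of_joint [IsProbabilityMeasure P] (hΦ₁_meas : Measurable Φ₁)
    (hΦ₂_meas : Measurable Φ₂) (hΦ_indep : IndepFun Φ₁ Φ₂ P) (hΦ₁ : IsLeftRotationInvariant P Φ₁)
    (hΦ₂ : IsLeftRotationInvariant P Φ₂ ∨ ∀ ω, IsIdentityKernel (Φ₂ ω))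
    (V : Submodule ℝ (EuclideanSpace ℝ (Fin n₁ ⊕ Fin n₂)))
    (h : finrank ℝ V < m₁ + m₂) (h₁ : finrank ℝ V < m₁ + finrank ℝ (V.map (sndₗ n₁ n₂)))
    (h₂ : m₁ ≤ finrank ℝ (V.map (fstₗ n₁ n₂))) :
    (∀ᵐ ω ∂P, ∀ v ∈ V, sensing (Φ₁ ω) (Φ₂ ω) v = 0 → fstₗ n₁ n₂ v = 0) ∧
    ∀ u ∉ V, ∀ᵐ ω ∂P, sensing (Φ₁ ω) (Φ₂ ω) u ∉ V.map (sensing (Φ₁ ω) (Φ₂ ω)) := by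
  have key : ∀ u, ∀ᵐ ω ∂P, ∀ w ∈ V ⊔ Submodule.span ℝ {u},
      sensing (Φ₁ ω) (Φ₂ ω) w = 0 → w = 0 := by
    intro u
    have hle : V ≤ V ⊔ Submodule.span ℝ {u} := le_sup_left
    have hd := finrank_sup_span_singleton_le V u
    have hd₁ := Submodule.finrank_mono (Submodule.map_mono (f := fstₗ n₁ n₂) hle)
    have hd₂ := Submodule.finrank_mono (Submodule.map_mono (f := sndₗ n₁ n₂) hle)
    -- The strict bounds absorb the extra dimension of `u`. The third bound combines `h` with `h₂`:
    -- `finrank V + 1 ≤ m₁ + m₂`, and `m₁` is at most the dimension of the first block.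
    exact ae_sensing_disjoint_ker hΦ₁_meas hΦ₂_meas hΦ_indep hΦ₁ hΦ₂ _
      (by omega) (by omega) (by omega)
  refine ⟨?_, fun u hu => ?_⟩
  · filter_upwards [key 0] with ω hω v hv hz
    rw [hω v (Submodule.mem_sup_left hv) hz, map_zero]
  · filter_upwards [key u] with ω hω ⟨v, hv, hvu⟩
    have h2 := hω (v - u) (Submodule.sub_mem _ (Submodule.mem_sup_left hv)
      (Submodule.mem_sup_right (Submodule.mem_span_singleton_self _)))
      (by rw [map_sub, hvu, sub_self])
    rw [sub_eq_zero] at h2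
    exact hu (h2 ▸ hv)

end GMMSideInfo

/-! ### Assembly over all pairs of classes -/

open GMMSideInfo Module in
theorem theorem4 {Ω : Type*} [MeasurableSpace Ω] (P : Measure Ω) [IsProbabilityMeasure P]
    {n₁ n₂ m₁ m₂ K₁ K₂ : ℕ} (M : GMMSideInfo.JointGMM n₁ n₂ K₁ K₂)
    (Φ₁ : Ω → Matrix (Fin m₁) (Fin n₁) ℝ) (Φ₂ : Ω → Matrix (Fin m₂) (Fin n₂) ℝ)
    (hΦ₁_meas : Measurable Φ₁) (hΦ₂_meas : Measurable Φ₂) (hΦ_indep : IndepFun Φ₁ Φ₂ P)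
    (hΦ₁ : GMMSideInfo.IsLeftRotationInvariant P Φ₁)
    (hΦ₂ : GMMSideInfo.IsLeftRotationInvariant P Φ₂ ∨
      ∀ ω, GMMSideInfo.IsIdentityKernel (Φ₂ ω))
    (hm : ∀ c ∈ M.support,
      M.rank₁ c < m₁ ∨
        ((M.rank c : ℤ) - (M.rank₂ c : ℤ) < (m₁ : ℤ) ∧ M.rank c < m₁ + m₂)) :
    ∀ᵐ ω ∂P, Tendsto (fun s : ℝ => M.mmseSideInfo (Φ₁ ω) (Φ₂ ω) s) (𝓝[>] 0) (𝓝 0) := by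
  classical
  let C : Finset (Fin K₁ × Fin K₂) := Finset.univ.filter (· ∈ M.support)
  have hC : ∀ c, c ∈ C ↔ c ∈ M.support := fun c => by simp [C]
  have hclass : ∀ c, ∃ U : Submodule ℝ (EuclideanSpace ℝ (Fin n₁ ⊕ Fin n₂)), c ∈ C →
      gaussianSpace (M.cov c) ≤ U ∧
      (∀ᵐ ω ∂P, ∀ v ∈ U, sensing (Φ₁ ω) (Φ₂ ω) v = 0 → fstₗ n₁ n₂ v = 0) ∧
      ∀ u ∉ U, ∀ᵐ ω ∂P, sensing (Φ₁ ω) (Φ₂ ω) u ∉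
        (gaussianSpace (M.cov c)).map (sensing (Φ₁ ω) (Φ₂ ω)) := by
    intro c
    by_cases hc : c ∈ C
    swap
    · exact ⟨⊤, fun h => absurd h hc⟩
    have h₀ : finrank ℝ (gaussianSpace (M.cov c)) = M.rank c :=
      finrank_gaussianSpace (M.cov_posSemidef c)
    have h₁ : finrank ℝ ((gaussianSpace (M.cov c)).map (fstₗ n₁ n₂)) = M.rank₁ c :=
      finrank_gaussianSpace_map_fst (M.cov_posSemidef c)
    have h₂ : finrank ℝ ((gaussianSpace (M.cov c)).map (sndₗ n₁ n₂)) = M.rank₂ c :=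
      finrank_gaussianSpace_map_snd (M.cov_posSemidef c)
    have hmc := hm c ((hC c).1 hc)
    -- Splitting on this inequality, rather than on `hmc`, supplies `m₁ ≤ rank₁` in the joint case,
    -- where it is needed.
    by_cases hr : M.rank₁ c < m₁
    · exact ⟨_, fun _ => ⟨Submodule.le_comap_map _ _,
        ae_separation_of_fst hΦ₁_meas hΦ₁ _ (h₁ ▸ hr)⟩⟩
    · exact ⟨_, fun _ => ⟨le_rfl, ae_separation_of_joint hΦ₁_meas hΦ₂_meas hΦ_indep hΦ₁ hΦ₂ _
        (by omega) (by omega) (by omega)⟩⟩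
  choose U hU using hclass
  have hsep : ∀ c ∈ C, ∀ d ∈ C, ∀ᵐ ω ∂P,
      (∀ v ∈ gaussianSpace (M.cov d), M.mean d + v - M.mean c ∈ U c) ∨
      ∃ v ∈ gaussianSpace (M.cov d), sensing (Φ₁ ω) (Φ₂ ω) (M.mean d + v - M.mean c) ∉
        (gaussianSpace (M.cov c)).map (sensing (Φ₁ ω) (Φ₂ ω)) := by
    intro c hc d _
    -- The alternative does not involve the kernels, so the witness `v` is fixed before they are
    -- drawn and one null set per pair of classes suffices.
    by_cases h : ∀ v ∈ gaussianSpace (M.cov d), M.mean d + v - M.mean c ∈ U c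
    · exact ae_of_all _ fun _ => Or.inl h
    · push Not at h
      obtain ⟨v, hv, hvU⟩ := h
      filter_upwards [(hU c hc).2.2 _ hvU] with ω hω
      exact Or.inr ⟨v, hv, hω⟩
  filter_upwards [(Finset.eventually_all C).2 fun c hc => (hU c hc).2.1,
    (Finset.eventually_all C).2 fun c hc => (Finset.eventually_all C).2 (hsep c hc)] with ω hω₁ hω₂
  obtain ⟨g, hg, hgx⟩ := exists_measurable_recovery M.mean M.cov (sensing (Φ₁ ω) (Φ₂ ω))
    (fstₗ n₁ n₂) C U (fun c hc => (hU c hc).1) hω₁ hω₂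
  exact M.tendsto_mmseSideInfo (Φ₁ ω) (Φ₂ ω) hg fun c hc => hgx c ((hC c).2 hc)
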